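/- **Setting.** Let $\mathbb{R}^2_{x<y}=\{(x,y)\in\mathbb{R}^2: x<y\}$ and $\Delta=\{x=y\}$. A persistence diagram is a measure $\mu_D=\sum_{p\in D}c_p\delta_p$ with $D\subset\mathbb{R}^2_{x<y}$ finite and $c_p\in\mathbb{N}$. For a Borel set $Z\subset\mathbb{R}^2$ put $\mathrm{pers}_Z(\mu)=\frac12\int_Z (y-x)\,d\mu(x,y)$, and let $B_r^c=\{p\in\mathbb{R}^2:\|p\|_2>r\}$. For a weighting $\omega$ that is positive on $\mathbb{R}^2_{x<y}$ put $\mu_D^\omega=\sum_{p\in D}\omega(p)c_p\delta_p$. The lift zonoid of a discrete measure $\mu=\sum_i c_i\delta_{p_i}$ is the Minkowski sum of segments $Z_\mu=\bigoplus_i c_i[0,(1,p_i)]\subset\mathbb{R}^3$ (with $Z_0=\{0\}$), and $d_H$ is the Hausdorff distance for the Euclidean norm of $\mathbb{R}^3$. The weighting $\omega$ is called *effective* if for every sequence $(\mu_{D_n})_n$ of persistence diagrams $$\lim_{r\to\infty}\sup_n\int_{B_r^c}\omega(p)\|p\|_2\,d\mu_{D_n}(p)=0\ \Longrightarrow\ \lim_{r\to\infty}\sup_n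 \mathrm{pers}_{B_r^c}(\mu_{D_n})=0.$$ A partial matching of $\mu_D=\sum_{p\in D} a_p\delta_p$ and $\mu_{D'}=\sum_{q\in D'} b_q\delta_q$ is a family $\gamma_{pq}\in\mathbb{N}$ ($p\in D$, $q\in D'$; the number of copies of $p$ matched with copies of $q$) with $\sum_q\gamma_{pq}\le a_p$ and $\sum_p\gamma_{pq}\le b_q$. Its cost is $$\sum_{p,q}\gamma_{pq}\|p-q\|_\infty+\sum_p\Big(a_p-\sum_q\gamma_{pq}\Big)\|p-\Delta\|_\infty+\sum_q\Big(b_q-\sum_p\gamma_{pq}\Big)\|q-\Delta\|_\infty ,$$ where $\|p-\Delta\|_\infty$ is the sup-norm distance of $p$ to $\Delta$, and $W_1(\mu_D,\mu_{D'})$ is the infimum of the costs of all partial matchings. **Theorem (continuity of the inverse).** Let $\omega$ be an effective weighting that is positive and continuous on $\mathbb{R}^2_{x<y}$ and such that on bounded sets it is bounded below by a multiple of the persistence: for every $R$ there is $c>0$ with $\omega(x,y)\ge c\,(y-x)$ for all $x<y$ with $\|(x,y)\|_2\le R$. (For a continuous $\omega:\mathbb{R}^2\to(0,1]$ this last condition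 holds automatically.) Let $\mu_{D_n}$ ($n\in\mathbb{N}$) and $\mu_D$ be persistence diagrams with $d_H(Z_{\mu^\omega_{D_n}},Z_{\mu^\omega_D})\to0$. Then $W_1(\mu_{D_n},\mu_D)\to0$. -/

import Mathlib

open Filter Topology MeasureTheory
open scoped Pointwise ENNReal

noncomputable section

namespace PersistenceSphere

/-- The plane with its Euclidean norm; `p 0` is the birth and `p 1` the death of a point `p`. -/
abbrev Plane : Type := EuclideanSpace ℝ (Fin 2)

/-- Three-dimensional Euclidean space, where lift zonoids live. -/
abbrev Space : Type := EuclideanSpace ℝ (Fin 3)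

/-- The open half-plane of points `(x, y)` with `x < y`. -/
def upperHalf : Set Plane := {p | p 0 < p 1}

/-- A persistence diagram: finitely many points of the open half-plane, the point `p` having
multiplicity `mult p`. -/
structure Diagram where
  mult : Plane →₀ ℕ
  mem_upperHalf : ∀ p ∈ mult.support, p ∈ upperHalf

/-- The measure `∑ c_p δ_p` of a persistence diagram. -/
def Diagram.toMeasure (D : Diagram) : Measure Plane :=
  ∑ p ∈ D.mult.support, (D.mult p : ℝ≥0∞) • Measure.dirac p

/-- The coefficients `ω(p) c_p` of the reweighted discrete measure `∑ ω(p) c_p δ_p`. -/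
def Diagram.reweight (ω : Plane → ℝ) (D : Diagram) : Plane →₀ ℝ :=
  Finsupp.onFinset D.mult.support (fun p => ω p * (D.mult p : ℝ)) (by
    intro p hp
    rw [Finsupp.mem_support_iff]
    rintro h
    simp [h] at hp)

/-- Half the integral of the persistence `y - x` over a set `Z`. -/
def persOn (Z : Set Plane) (μ : Measure Plane) : ℝ :=
  (1 / 2) * ∫ p in Z, (p 1 - p 0) ∂μ

/-- The point `(1, p)` of three-dimensional space. -/
def lift (p : Plane) : Space := !₂[1, p 0, p 1]

/-- The lift zonoid of the discrete measure `∑ c_p δ_p`: the Minkowski sum of the scaled segments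
`c_p [0, (1, p)]` (for the zero measure, the set `{0}`). -/
def liftZonoid (c : Plane →₀ ℝ) : Set Space :=
  ∑ p ∈ c.support, c p • segment ℝ 0 (lift p)

/-- The defining condition of an effective weighting; the suprema over `n` are taken in `[0, ∞]`
(both integrands are nonnegative at the points of a diagram when `ω` is). -/
def IsEffective (ω : Plane → ℝ) : Prop :=
  ∀ D : ℕ → Diagram,
    Tendsto (fun r : ℝ => ⨆ n, ENNReal.ofReal
        (∫ p in (Metric.closedBall (0 : Plane) r)ᶜ, ω p * ‖p‖ ∂(D n).toMeasure)) atTop (𝓝 0) →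
    Tendsto (fun r : ℝ => ⨆ n, ENNReal.ofReal
        (persOn (Metric.closedBall (0 : Plane) r)ᶜ (D n).toMeasure)) atTop (𝓝 0)

/-- The distance of two points of the plane in the sup norm. -/
def supDist (p q : Plane) : ℝ := max |p 0 - q 0| |p 1 - q 1|

/-- The sup-norm distance of a point to the diagonal. -/
def diagDist (p : Plane) : ℝ := ⨅ t : ℝ, supDist p !₂[t, t]

theorem diagDist_eq (p : Plane) : diagDist p = |p 1 - p 0| / 2 := by
  have key : ∀ t : ℝ, |p 1 - p 0| / 2 ≤ supDist p !₂[t, t] := by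
    intro t
    have h1 : |p 0 - t| ≤ supDist p !₂[t, t] := by simp [supDist]
    have h2 : |p 1 - t| ≤ supDist p !₂[t, t] := by simp [supDist]
    have h3 := abs_sub (p 1 - t) (p 0 - t)
    rw [sub_sub_sub_cancel_right] at h3
    linarith
  apply le_antisymm
  · refine (ciInf_le ⟨_, Set.forall_mem_range.2 key⟩ ((p 0 + p 1) / 2)).trans ?_
    have e1 : p 0 - (p 0 + p 1) / 2 = -((p 1 - p 0) / 2) := by ring
    have e2 : p 1 - (p 0 + p 1) / 2 = (p 1 - p 0) / 2 := by ring
    simp [supDist, e1, e2, abs_div]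
  · exact le_ciInf key

/-- A partial matching of two diagrams, with multiplicities: `amount p q` of the copies of `p` are
matched with copies of `q`; the copies that are left over are matched with the diagonal. -/
structure PartialMatching (D D' : Diagram) where
  amount : Plane → Plane → ℕ
  left_le : ∀ p ∈ D.mult.support, ∑ q ∈ D'.mult.support, amount p q ≤ D.mult p
  right_le : ∀ q ∈ D'.mult.support, ∑ p ∈ D.mult.support, amount p q ≤ D'.mult q

/-- The cost of a partial matching. -/
def PartialMatching.cost {D D' : Diagram} (γ : PartialMatching D D') : ℝ :=
  (∑ p ∈ D.mult.support, ∑ q ∈ D'.mult.support, (γ.amount p q : ℝ) * supDist p q)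
  + (∑ p ∈ D.mult.support,
      ((D.mult p : ℝ) - ∑ q ∈ D'.mult.support, (γ.amount p q : ℝ)) * diagDist p)
  + (∑ q ∈ D'.mult.support,
      ((D'.mult q : ℝ) - ∑ p ∈ D.mult.support, (γ.amount p q : ℝ)) * diagDist q)

/-- The `1`-Wasserstein distance of two persistence diagrams. -/
def W₁ (D D' : Diagram) : ℝ := ⨅ γ : PartialMatching D D', γ.cost

end PersistenceSphere

end

namespace PersistenceSphere

/-! ### Support functions of lift zonoids -/

/-! The support function of a lift zonoid in direction `(t, a, b)` is the integral of `max 0 (t + a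
x + b y)`. Hausdorff convergence therefore gives convergence of the integrals of these hinge
functions, hence of their linear span `convergentTests`. This span contains trapezoidal bumps in any
linear coordinate `x + t y`.

Because the limit has finite support `S`, such ridge functions suffice. A point far from `S` may
share a ridge value with a point of `S` in some directions, but not in all of `S.card + 1` suitable
ones. A sum of ridge gaps over these directions vanishes on `S` and dominates the indicator of the
far set, so the far weighted mass tends to `0` (`tendsto_wsum_farFrom`). The mass near each `q ∈ S`
then converges to its limit value; continuity of `ω` and integrality of multiplicities turn this
into an exact count (`eventually_count_near`).

Nearby points are matched with `q`, all others with the diagonal. The persistence of the others is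
controlled by the far mass in a ball, where `ω` dominates persistence, and by effectiveness outside
it (`exists_forall_persOn_le`). -/

theorem exists_mem_liftZonoid_inner_eq (c : Plane →₀ ℝ) (u : Space) :
    ∃ z ∈ liftZonoid c,
      inner ℝ u z = ∑ p ∈ c.support, c p * max 0 (inner ℝ u (lift p)) := by
  classical
  refine ⟨∑ p ∈ c.support, c p • (if 0 ≤ inner ℝ u (lift p) then lift p else 0),
    Set.finsetSum_mem_finsetSum _ _ _ fun p _ => Set.smul_mem_smul_set ?_, ?_⟩
  · split_ifs
    exacts [right_mem_segment ℝ _ _, left_mem_segment ℝ _ _]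
  · rw [inner_sum]
    refine Finset.sum_congr rfl fun p _ => ?_
    rw [inner_smul_right]
    split_ifs with h
    · rw [max_eq_right h]
    · rw [max_eq_left (not_le.1 h).le, inner_zero_right]

theorem inner_le_of_mem_liftZonoid {c : Plane →₀ ℝ} (hc : ∀ p, 0 ≤ c p) (u : Space) {z : Space}
    (hz : z ∈ liftZonoid c) :
    inner ℝ u z ≤ ∑ p ∈ c.support, c p * max 0 (inner ℝ u (lift p)) := by
  obtain ⟨g, hg, rfl⟩ := (Set.mem_finsetSum _ _ _).1 hz
  rw [inner_sum]
  refine Finset.sum_le_sum fun p hp => ?_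
  obtain ⟨y, hy, hyg⟩ := hg hp
  rw [← hyg]
  simp only
  rw [inner_smul_right]
  refine mul_le_mul_of_nonneg_left ?_ (hc p)
  rw [segment_eq_image] at hy
  obtain ⟨θ, ⟨h0, h1⟩, rfl⟩ := hy
  simp only [smul_zero, zero_add, inner_smul_right]
  rcases le_total 0 (inner ℝ u (lift p)) with h | h
  · exact le_max_of_le_right (mul_le_of_le_one_left h h1)
  · exact le_max_of_le_left (mul_nonpos_of_nonneg_of_nonpos h0 h)

theorem isCompact_liftZonoid (c : Plane →₀ ℝ) : IsCompact (liftZonoid c) := by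
  refine Finset.sum_induction _ IsCompact (fun _ _ => IsCompact.add) isCompact_singleton
    fun p _ => IsCompact.smul _ ?_
  rw [segment_eq_image]
  exact isCompact_Icc.image (by fun_prop)

theorem liftZonoid_nonempty (c : Plane →₀ ℝ) : (liftZonoid c).Nonempty :=
  (exists_mem_liftZonoid_inner_eq c 0).imp fun _ h => h.1

/-- A maximizer in the first zonoid has a point of the second within the Hausdorff distance, and
Cauchy–Schwarz bounds the loss. Swapping the roles gives the reverse estimate. -/
theorem support_le_support_add_hausdorffDist (c : Plane →₀ ℝ) {d : Plane →₀ ℝ}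
    (hd : ∀ p, 0 ≤ d p) (u : Space) :
    ∑ p ∈ c.support, c p * max 0 (inner ℝ u (lift p)) ≤
      ∑ p ∈ d.support, d p * max 0 (inner ℝ u (lift p)) +
        ‖u‖ * Metric.hausdorffDist (liftZonoid c) (liftZonoid d) := by
  obtain ⟨z, hz, hzu⟩ := exists_mem_liftZonoid_inner_eq c u
  obtain ⟨w, hw, hzw⟩ := (isCompact_liftZonoid d).exists_infDist_eq_dist (liftZonoid_nonempty d) z
  have hfin := Metric.hausdorffEDist_ne_top_of_nonempty_of_bounded (liftZonoid_nonempty c)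
    (liftZonoid_nonempty d) (isCompact_liftZonoid c).isBounded (isCompact_liftZonoid d).isBounded
  have h1 := Metric.infDist_le_hausdorffDist_of_mem hz hfin
  rw [hzw, dist_eq_norm] at h1
  have h2 := real_inner_le_norm u (z - w)
  rw [inner_sub_right] at h2
  have h3 := inner_le_of_mem_liftZonoid hd u hw
  have h4 := mul_le_mul_of_nonneg_left h1 (norm_nonneg u)
  linarith

/-! ### Weighted sums over diagrams -/

/-- The integral of `f` against the reweighted measure of a diagram. -/
def Diagram.wsum (ω : Plane → ℝ) (D : Diagram) (f : Plane → ℝ) : ℝ :=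
  ∑ p ∈ D.mult.support, ω p * D.mult p * f p

theorem Diagram.sum_reweight (ω : Plane → ℝ) (D : Diagram) (f : Plane → ℝ) :
    ∑ p ∈ (D.reweight ω).support, D.reweight ω p * f p = D.wsum ω f := by
  refine Finset.sum_subset Finsupp.support_onFinset_subset fun p _ hp => ?_
  rw [Finsupp.notMem_support_iff.1 hp, zero_mul]

theorem Diagram.weight_nonneg {ω : Plane → ℝ} (hω : ∀ p ∈ upperHalf, 0 < ω p) (D : Diagram)
    {p : Plane} (hp : p ∈ D.mult.support) : 0 ≤ ω p * D.mult p :=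
  mul_nonneg (hω p (D.mem_upperHalf p hp)).le (Nat.cast_nonneg _)

theorem Diagram.reweight_nonneg {ω : Plane → ℝ} (hω : ∀ p ∈ upperHalf, 0 < ω p) (D : Diagram)
    (p : Plane) : 0 ≤ D.reweight ω p := by
  by_cases hp : p ∈ D.mult.support
  · exact D.weight_nonneg hω hp
  · simp [Diagram.reweight, Finsupp.notMem_support_iff.1 hp]

theorem Diagram.wsum_mono {ω : Plane → ℝ} (hω : ∀ p ∈ upperHalf, 0 < ω p) (D : Diagram)
    {f g : Plane → ℝ} (h : ∀ p, f p ≤ g p) : D.wsum ω f ≤ D.wsum ω g :=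
  Finset.sum_le_sum fun p hp => mul_le_mul_of_nonneg_left (h p) (D.weight_nonneg hω hp)

theorem Diagram.wsum_nonneg {ω : Plane → ℝ} (hω : ∀ p ∈ upperHalf, 0 < ω p) (D : Diagram)
    {f : Plane → ℝ} (h : ∀ p, 0 ≤ f p) : 0 ≤ D.wsum ω f :=
  Finset.sum_nonneg fun p hp => mul_nonneg (D.weight_nonneg hω hp) (h p)

theorem Diagram.wsum_add (ω : Plane → ℝ) (D : Diagram) (f g : Plane → ℝ) :
    D.wsum ω (f + g) = D.wsum ω f + D.wsum ω g := by
  simp [Diagram.wsum, mul_add, Finset.sum_add_distrib]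

theorem Diagram.wsum_smul (ω : Plane → ℝ) (D : Diagram) (a : ℝ) (f : Plane → ℝ) :
    D.wsum ω (a • f) = a * D.wsum ω f := by
  simp only [Diagram.wsum, Finset.mul_sum, Pi.smul_apply, smul_eq_mul]
  exact Finset.sum_congr rfl fun p _ => by ring

theorem Diagram.wsum_eq_zero (ω : Plane → ℝ) (D : Diagram) {f : Plane → ℝ}
    (h : ∀ p ∈ D.mult.support, f p = 0) : D.wsum ω f = 0 :=
  Finset.sum_eq_zero fun p hp => by rw [h p hp, mul_zero]

/-- The functions whose integrals against the reweighted measures of `D n` converge to the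
integral against the reweighted measure of `D'`. -/
def convergentTests (ω : Plane → ℝ) (D : ℕ → Diagram) (D' : Diagram) :
    Submodule ℝ (Plane → ℝ) where
  carrier := {f | Tendsto (fun n => (D n).wsum ω f) atTop (𝓝 (D'.wsum ω f))}
  add_mem' {f g} hf hg := by
    simp only [Set.mem_ofPred_eq, Diagram.wsum_add] at *
    exact hf.add hg
  zero_mem' := by simp [Diagram.wsum]
  smul_mem' a f hf := by
    simp only [Set.mem_ofPred_eq, Diagram.wsum_smul] at *
    exact hf.const_mul a

theorem inner_lift (t a b : ℝ) (p : Plane) :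
    inner ℝ (!₂[t, a, b] : Space) (lift p) = t + a * p 0 + b * p 1 := by
  simp [lift, PiLp.inner_apply, Fin.sum_univ_three]
  ring

theorem max_affine_mem_convergentTests {ω : Plane → ℝ} (hω : ∀ p ∈ upperHalf, 0 < ω p)
    {D : ℕ → Diagram} {D' : Diagram}
    (hD : Tendsto (fun n => Metric.hausdorffDist (liftZonoid ((D n).reweight ω))
      (liftZonoid (D'.reweight ω))) atTop (𝓝 0)) (t a b : ℝ) :
    (fun p : Plane => max 0 (t + a * p 0 + b * p 1)) ∈ convergentTests ω D D' := by
  have key (E : Diagram) : ∑ p ∈ (E.reweight ω).support, E.reweight ω p *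
      max 0 (inner ℝ (!₂[t, a, b] : Space) (lift p)) =
        E.wsum ω (fun p : Plane => max 0 (t + a * p 0 + b * p 1)) := by
    simp only [inner_lift]
    exact E.sum_reweight ω fun p : Plane => max 0 (t + a * p 0 + b * p 1)
  have h0 := hD.const_mul ‖(!₂[t, a, b] : Space)‖
  rw [mul_zero] at h0
  refine tendsto_iff_dist_tendsto_zero.2 (squeeze_zero (fun _ => dist_nonneg) (fun n => ?_) h0)
  have h1 := support_le_support_add_hausdorffDist ((D n).reweight ω) (D'.reweight_nonneg hω)
    !₂[t, a, b]
  have h2 := support_le_support_add_hausdorffDist (D'.reweight ω) ((D n).reweight_nonneg hω)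
    !₂[t, a, b]
  rw [Metric.hausdorffDist_comm] at h2
  simp only [key] at h1 h2
  rw [Real.dist_eq, abs_le]
  constructor <;> linarith

/-! ### Trapezoidal ridge functions -/

/-- The piecewise linear function equal to `1` on `[-δ, δ]` and to `0` off `[-2δ, 2δ]`. -/
noncomputable def trapezoid (δ s : ℝ) : ℝ :=
  δ⁻¹ * (max 0 (s + 2 * δ) - max 0 (s + δ) - max 0 (s - δ) + max 0 (s - 2 * δ))

theorem trapezoid_nonneg {δ : ℝ} (hδ : 0 < δ) (s : ℝ) : 0 ≤ trapezoid δ s := by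
  refine mul_nonneg (inv_nonneg.2 hδ.le) ?_
  grind

theorem trapezoid_le_one {δ : ℝ} (hδ : 0 < δ) (s : ℝ) : trapezoid δ s ≤ 1 := by
  rw [trapezoid, inv_mul_le_iff₀ hδ]
  grind

theorem trapezoid_eq_one {δ s : ℝ} (hδ : 0 < δ) (hs : |s| ≤ δ) : trapezoid δ s = 1 := by
  rw [trapezoid, inv_mul_eq_iff_eq_mul₀ hδ.ne']
  grind

theorem trapezoid_eq_zero {δ s : ℝ} (hδ : 0 < δ) (hs : 2 * δ ≤ |s|) : trapezoid δ s = 0 := by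
  refine mul_eq_zero_of_right _ ?_
  grind

/-- The linear coordinate of the plane in the direction `(1, t)`. -/
def ridge (t : ℝ) (p : Plane) : ℝ := p 0 + t * p 1

theorem trapezoid_ridge_mem_convergentTests {ω : Plane → ℝ} (hω : ∀ p ∈ upperHalf, 0 < ω p)
    {D : ℕ → Diagram} {D' : Diagram}
    (hD : Tendsto (fun n => Metric.hausdorffDist (liftZonoid ((D n).reweight ω))
      (liftZonoid (D'.reweight ω))) atTop (𝓝 0)) (t δ s : ℝ) :
    (fun p => trapezoid δ (ridge t p - s)) ∈ convergentTests ω D D' := by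
  have h (a : ℝ) := max_affine_mem_convergentTests hω hD a 1 t
  convert Submodule.smul_mem _ δ⁻¹ (add_mem (sub_mem (sub_mem (h (-s + 2 * δ)) (h (-s + δ)))
    (h (-s - δ))) (h (-s - 2 * δ))) using 1
  ext p
  have e (a : ℝ) : -s + a + 1 * p 0 + t * p 1 = p 0 + t * p 1 - s + a := by ring
  have e' (a : ℝ) : -s - a + 1 * p 0 + t * p 1 = p 0 + t * p 1 - s - a := by ring
  simp only [trapezoid, ridge, Pi.smul_apply, Pi.add_apply, Pi.sub_apply, smul_eq_mul, e, e']

theorem one_mem_convergentTests {ω : Plane → ℝ} (hω : ∀ p ∈ upperHalf, 0 < ω p)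
    {D : ℕ → Diagram} {D' : Diagram}
    (hD : Tendsto (fun n => Metric.hausdorffDist (liftZonoid ((D n).reweight ω))
      (liftZonoid (D'.reweight ω))) atTop (𝓝 0)) :
    (1 : Plane → ℝ) ∈ convergentTests ω D D' := by
  convert max_affine_mem_convergentTests hω hD 1 0 0 using 1
  ext p
  simp

/-- Two distinct points share a ridge value for at most one slope `t`, so only finitely many slopes
are bad. -/
theorem infinite_injOn_ridge (S : Finset Plane) :
    {t : ℝ | Set.InjOn (ridge t) S}.Infinite := by
  classical
  have hfin : {t : ℝ | ¬ Set.InjOn (ridge t) S}.Finite := by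
    refine ((S ×ˢ S).image fun x => -(x.1 0 - x.2 0) / (x.1 1 - x.2 1)).finite_toSet.subset ?_
    intro t ht
    simp only [Set.InjOn, Set.mem_ofPred_eq, not_forall] at ht
    obtain ⟨p, hp, q, hq, h, hne⟩ := ht
    simp only [ridge] at h
    simp only [Finset.coe_image, Set.mem_image, Finset.coe_product, Prod.exists, Set.mem_prod]
    refine ⟨p, q, ⟨hp, hq⟩, ?_⟩
    have h1 : p 1 - q 1 ≠ 0 := by
      intro h1
      have h1 := sub_eq_zero.1 h1
      refine hne ?_
      ext i
      fin_cases i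
      · simpa [h1] using h
      · exact h1
    rw [div_eq_iff h1]
    linarith
  convert hfin.infinite_compl using 1
  ext t
  simp

theorem eventually_ridge_separates {S : Finset Plane} {t : ℝ} (ht : Set.InjOn (ridge t) S) :
    ∀ᶠ δ in 𝓝[>] (0 : ℝ), ∀ p ∈ S, ∀ q ∈ S, p ≠ q → 4 * δ < |ridge t p - ridge t q| := by
  rw [Finset.eventually_all]
  intro p hp
  rw [Finset.eventually_all]
  intro q hq
  by_cases hne : p = q
  · simp [hne]
  have h : 0 < |ridge t p - ridge t q| := abs_pos.2 (sub_ne_zero.2 fun h => hne (ht hp hq h))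
  filter_upwards [nhdsWithin_le_nhds (Iio_mem_nhds (show 0 < |ridge t p - ridge t q| / 4 by
    positivity))] with δ hδ _
  rw [Set.mem_Iio] at hδ
  linarith

/-! ### Concentration near the limit diagram -/

/-- The points at sup-norm distance at least `ε` from a finite set. -/
def farFrom (S : Finset Plane) (ε : ℝ) : Set Plane := {p | ∀ q ∈ S, ε ≤ supDist p q}

/-- Two ridge coordinates determine a point: Cramer's rule with determinant `t - t'` recovers `p -
q`, and `h1`, `h2` absorb the resulting error constants. -/
theorem supDist_lt_of_ridge {t t' δ ε : ℝ} {p q : Plane} (h : |ridge t p - ridge t q| < 2 * δ)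
    (h' : |ridge t' p - ridge t' q| < 2 * δ) (h1 : 4 * δ ≤ ε * |t - t'|)
    (h2 : 2 * δ * (|t| + |t'|) ≤ ε * |t - t'|) (hne : t ≠ t') : supDist p q < ε := by
  have hpos : 0 < |t - t'| := abs_pos.2 (sub_ne_zero.2 hne)
  have ey : (p 1 - q 1) * (t - t') = (ridge t p - ridge t q) - (ridge t' p - ridge t' q) := by
    simp only [ridge]; ring
  have ex : (p 0 - q 0) * (t - t') =
      t * (ridge t' p - ridge t' q) - t' * (ridge t p - ridge t q) := by
    simp only [ridge]; ring
  refine max_lt ?_ ?_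
  · refine lt_of_mul_lt_mul_right ?_ hpos.le
    rw [← abs_mul, ex]
    refine (abs_sub _ _).trans_lt (lt_of_lt_of_le ?_ h2)
    rw [abs_mul, abs_mul]
    -- One slope must be nonzero for the inequality to stay strict.
    have : 0 < |t| ∨ 0 < |t'| := by
      by_contra! hc
      exact hne ((abs_nonpos_iff.1 hc.1).trans (abs_nonpos_iff.1 hc.2).symm)
    rcases this with h0 | h0
    · nlinarith [mul_lt_mul_of_pos_left h' h0, mul_le_mul_of_nonneg_left h.le (abs_nonneg t')]
    · nlinarith [mul_lt_mul_of_pos_left h h0, mul_le_mul_of_nonneg_left h'.le (abs_nonneg t)]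
  · refine lt_of_mul_lt_mul_right ?_ hpos.le
    rw [← abs_mul, ey]
    refine (abs_sub _ _).trans_lt ?_
    linarith

/-- Pigeonhole: otherwise every slope in `T` has a point of `S` nearby in ridge value, two slopes
share that point, and then `p` itself is close to it. -/
theorem eventually_farFrom_imp_ridge_far (S : Finset Plane) {T : Finset ℝ}
    (hcard : S.card < T.card) {ε : ℝ} (hε : 0 < ε) :
    ∀ᶠ δ in 𝓝[>] (0 : ℝ), ∀ p : Plane, p ∈ farFrom S ε →
      ∃ t ∈ T, ∀ q ∈ S, 2 * δ ≤ |ridge t p - ridge t q| := by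
  have hev : ∀ᶠ δ in 𝓝[>] (0 : ℝ), ∀ t ∈ T, ∀ t' ∈ T, t ≠ t' →
      4 * δ ≤ ε * |t - t'| ∧ 2 * δ * (|t| + |t'|) ≤ ε * |t - t'| := by
    rw [Finset.eventually_all]
    intro t _
    rw [Finset.eventually_all]
    intro t' _
    by_cases hne : t = t'
    · simp [hne]
    have hpos : 0 < ε * |t - t'| := mul_pos hε (abs_pos.2 (sub_ne_zero.2 hne))
    have h1 : Tendsto (fun δ : ℝ => 4 * δ) (𝓝 0) (𝓝 0) := by
      simpa using (continuous_const_mul (4 : ℝ)).tendsto 0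
    have h2 : Tendsto (fun δ : ℝ => 2 * δ * (|t| + |t'|)) (𝓝 0) (𝓝 0) := by
      have : Continuous fun δ : ℝ => 2 * δ * (|t| + |t'|) := by fun_prop
      simpa using this.tendsto 0
    filter_upwards [nhdsWithin_le_nhds (h1.eventually_le_const hpos),
      nhdsWithin_le_nhds (h2.eventually_le_const hpos)] with δ a b _ using ⟨a, b⟩
  filter_upwards [hev] with δ hδ p hp
  by_contra! hc
  choose! f hfS hf using hc
  obtain ⟨t, ht, t', ht', hne, heq⟩ := Finset.exists_ne_map_eq_of_card_lt_of_maps_to hcard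
    (f := f) fun t ht => hfS t ht
  have h' := hf t' ht'
  rw [← heq] at h'
  exact absurd (hp _ (hfS t ht)) (not_le.2 (supDist_lt_of_ridge (hf t ht) h'
    (hδ t ht t' ht' hne).1 (hδ t ht t' ht' hne).2 hne))

/-- One minus the sum of the trapezoids around the values of a ridge on a finite set. -/
noncomputable def ridgeGap (S : Finset Plane) (δ t : ℝ) (p : Plane) : ℝ :=
  1 - ∑ q ∈ S, trapezoid δ (ridge t p - ridge t q)

theorem ridgeGap_mem_convergentTests {ω : Plane → ℝ} (hω : ∀ p ∈ upperHalf, 0 < ω p)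
    {D : ℕ → Diagram} {D' : Diagram}
    (hD : Tendsto (fun n => Metric.hausdorffDist (liftZonoid ((D n).reweight ω))
      (liftZonoid (D'.reweight ω))) atTop (𝓝 0)) (S : Finset Plane) (δ t : ℝ) :
    ridgeGap S δ t ∈ convergentTests ω D D' := by
  convert sub_mem (one_mem_convergentTests hω hD) (sum_mem fun q (_ : q ∈ S) =>
    trapezoid_ridge_mem_convergentTests hω hD t δ (ridge t q)) using 1
  ext p
  simp [ridgeGap]

/-- Ridge values more than `4 * δ` apart make bumps of half-width `2 * δ` disjoint. -/
theorem trapezoid_eq_zero_of_separated {S : Finset Plane} {δ t : ℝ} (hδ : 0 < δ)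
    (hsep : ∀ p ∈ S, ∀ q ∈ S, p ≠ q → 4 * δ < |ridge t p - ridge t q|) {p q q' : Plane}
    (hq : q ∈ S) (hq' : q' ∈ S) (hne : q' ≠ q) (hp : |ridge t p - ridge t q| < 2 * δ) :
    trapezoid δ (ridge t p - ridge t q') = 0 := by
  refine trapezoid_eq_zero hδ ?_
  have h1 := hsep q' hq' q hq hne
  have h2 := abs_sub_le (ridge t q') (ridge t p) (ridge t q)
  rw [abs_sub_comm (ridge t q') (ridge t p)] at h2
  linarith

theorem ridgeGap_nonneg {S : Finset Plane} {δ t : ℝ} (hδ : 0 < δ)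
    (hsep : ∀ p ∈ S, ∀ q ∈ S, p ≠ q → 4 * δ < |ridge t p - ridge t q|) (p : Plane) :
    0 ≤ ridgeGap S δ t p := by
  rw [ridgeGap, sub_nonneg]
  by_cases h : ∃ q ∈ S, |ridge t p - ridge t q| < 2 * δ
  · obtain ⟨q, hq, hpq⟩ := h
    rw [Finset.sum_eq_single_of_mem q hq fun q' hq' hne =>
      trapezoid_eq_zero_of_separated hδ hsep hq hq' hne hpq]
    exact trapezoid_le_one hδ _
  · push Not at h
    rw [Finset.sum_eq_zero fun q hq => trapezoid_eq_zero hδ (h q hq)]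
    exact zero_le_one

theorem ridgeGap_eq_zero {S : Finset Plane} {δ t : ℝ} (hδ : 0 < δ)
    (hsep : ∀ p ∈ S, ∀ q ∈ S, p ≠ q → 4 * δ < |ridge t p - ridge t q|) {p : Plane} (hp : p ∈ S) :
    ridgeGap S δ t p = 0 := by
  have h0 : |ridge t p - ridge t p| < 2 * δ := by simpa using hδ
  rw [ridgeGap, Finset.sum_eq_single_of_mem p hp fun q' hq' hne =>
      trapezoid_eq_zero_of_separated hδ hsep hp hq' hne h0,
    trapezoid_eq_one hδ (by simpa using hδ.le), sub_self]

/-- The mass of the reweighted diagrams away from the points of the limit diagram vanishes. -/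
theorem tendsto_wsum_farFrom {ω : Plane → ℝ} (hω : ∀ p ∈ upperHalf, 0 < ω p)
    {D : ℕ → Diagram} {D' : Diagram}
    (hD : Tendsto (fun n => Metric.hausdorffDist (liftZonoid ((D n).reweight ω))
      (liftZonoid (D'.reweight ω))) atTop (𝓝 0)) {ε : ℝ} (hε : 0 < ε) :
    Tendsto (fun n => (D n).wsum ω ((farFrom D'.mult.support ε).indicator 1)) atTop (𝓝 0) := by
  set S := D'.mult.support
  obtain ⟨T, hT, hcard⟩ := (infinite_injOn_ridge S).exists_subset_card_eq (S.card + 1)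
  have hsep : ∀ᶠ δ in 𝓝[>] (0 : ℝ), ∀ t ∈ T, ∀ p ∈ S, ∀ q ∈ S, p ≠ q →
      4 * δ < |ridge t p - ridge t q| :=
    (Finset.eventually_all T).2 fun t ht => eventually_ridge_separates (hT ht)
  obtain ⟨δ, ⟨hδs, hδf⟩, hδ⟩ := ((hsep.and (eventually_farFrom_imp_ridge_far S (T := T)
    (by omega) hε)).and self_mem_nhdsWithin).exists
  -- Every gap is nonnegative and vanishes on `S`, while at each far point some gap equals `1`.
  have hmem : ∑ t ∈ T, ridgeGap S δ t ∈ convergentTests ω D D' :=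
    sum_mem fun t _ => ridgeGap_mem_convergentTests hω hD S δ t
  have hlim : Tendsto (fun n => (D n).wsum ω (∑ t ∈ T, ridgeGap S δ t)) atTop
      (𝓝 (D'.wsum ω (∑ t ∈ T, ridgeGap S δ t))) := hmem
  rw [D'.wsum_eq_zero ω fun p hp => by
    rw [Finset.sum_apply, Finset.sum_eq_zero fun t ht => ridgeGap_eq_zero hδ (hδs t ht) hp]] at hlim
  refine squeeze_zero (fun n => (D n).wsum_nonneg hω fun p =>
    Set.indicator_nonneg (fun _ _ => zero_le_one) p) (fun n => (D n).wsum_mono hω fun p => ?_) hlim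
  rw [Finset.sum_apply]
  have hnn : ∀ t ∈ T, 0 ≤ ridgeGap S δ t p := fun t ht => ridgeGap_nonneg hδ (hδs t ht) p
  by_cases hp : p ∈ farFrom S ε
  · obtain ⟨t, ht, h⟩ := hδf p hp
    rw [Set.indicator_of_mem hp]
    refine le_trans ?_ (Finset.single_le_sum hnn ht)
    rw [ridgeGap, Finset.sum_eq_zero fun q hq => trapezoid_eq_zero hδ (h q hq)]
    simp
  · rw [Set.indicator_of_notMem hp]
    exact Finset.sum_nonneg hnn

theorem abs_ridge_sub_le (t : ℝ) (p q : Plane) :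
    |ridge t p - ridge t q| ≤ (1 + |t|) * supDist p q := by
  have e : ridge t p - ridge t q = (p 0 - q 0) + t * (p 1 - q 1) := by
    simp only [ridge]; ring
  rw [e, add_mul, one_mul]
  refine (abs_add_le _ _).trans (add_le_add (le_max_left _ _) ?_)
  rw [abs_mul]
  exact mul_le_mul_of_nonneg_left (le_max_right _ _) (abs_nonneg t)

/-- A single trapezoid works: ridges are Lipschitz, so small balls around `q` lie in its plateau and
those around other points of `S` miss its support. Its strip also reaches points far from `S`, where
only the bounds `0` and `1` are available. -/
theorem eventually_exists_isolating_test {ω : Plane → ℝ} (hω : ∀ p ∈ upperHalf, 0 < ω p)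
    {D : ℕ → Diagram} {D' : Diagram}
    (hD : Tendsto (fun n => Metric.hausdorffDist (liftZonoid ((D n).reweight ω))
      (liftZonoid (D'.reweight ω))) atTop (𝓝 0)) {S : Finset Plane} {q : Plane} (hq : q ∈ S) :
    ∀ᶠ ε in 𝓝[>] (0 : ℝ), ∃ h ∈ convergentTests ω D D', (∀ p, 0 ≤ h p) ∧ (∀ p, h p ≤ 1) ∧
      (∀ p, supDist p q < ε → h p = 1) ∧
      ∀ q' ∈ S, q' ≠ q → ∀ p, supDist p q' < ε → h p = 0 := by
  obtain ⟨t, ht⟩ := (infinite_injOn_ridge S).nonempty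
  obtain ⟨δ, hsep, hδ⟩ := ((eventually_ridge_separates ht).and self_mem_nhdsWithin).exists
  replace hδ : 0 < δ := hδ
  have ht0 : 0 < 1 + |t| := by positivity
  have hev : ∀ᶠ ε in 𝓝 (0 : ℝ), (1 + |t|) * ε ≤ δ := by
    have := (continuous_const_mul (1 + |t|)).tendsto 0
    rw [mul_zero] at this
    exact this.eventually_le_const hδ
  filter_upwards [nhdsWithin_le_nhds hev] with ε hε
  have hnear {p q : Plane} (h : supDist p q < ε) : |ridge t p - ridge t q| ≤ δ :=
    (abs_ridge_sub_le t p q).trans ((mul_le_mul_of_nonneg_left h.le ht0.le).trans hε)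
  refine ⟨_, trapezoid_ridge_mem_convergentTests hω hD t δ (ridge t q),
    fun p => trapezoid_nonneg hδ _, fun p => trapezoid_le_one hδ _,
    fun p hp => trapezoid_eq_one hδ (hnear hp), fun q' hq' hne p hp => ?_⟩
  have h := hnear hp
  exact trapezoid_eq_zero_of_separated hδ hsep hq' hq hne.symm (by linarith)

theorem supDist_self (p : Plane) : supDist p p = 0 := by simp [supDist]

theorem supDist_nonneg (p q : Plane) : 0 ≤ supDist p q :=
  (abs_nonneg _).trans (le_max_left _ _)

/-- The mass of the reweighted diagrams near a point of the limit diagram converges. -/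
theorem eventually_tendsto_wsum_near {ω : Plane → ℝ} (hω : ∀ p ∈ upperHalf, 0 < ω p)
    {D : ℕ → Diagram} {D' : Diagram}
    (hD : Tendsto (fun n => Metric.hausdorffDist (liftZonoid ((D n).reweight ω))
      (liftZonoid (D'.reweight ω))) atTop (𝓝 0)) {q : Plane} (hq : q ∈ D'.mult.support) :
    ∀ᶠ ε in 𝓝[>] (0 : ℝ), Tendsto (fun n => (D n).wsum ω ({p | supDist p q < ε}.indicator 1))
      atTop (𝓝 (ω q * D'.mult q)) := by
  filter_upwards [eventually_exists_isolating_test hω hD hq, self_mem_nhdsWithin]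
    with ε ⟨h, hmem, h0, h1, hone, hzero⟩ hε
  replace hε : 0 < ε := hε
  have hlim : Tendsto (fun n => (D n).wsum ω h) atTop (𝓝 (D'.wsum ω h)) := hmem
  have hval : D'.wsum ω h = ω q * D'.mult q := by
    rw [Diagram.wsum, Finset.sum_eq_single_of_mem q hq fun q' hq' hne => by
      rw [hzero q' hq' hne q' (by rwa [supDist_self]), mul_zero],
      hone q (by rwa [supDist_self]), mul_one]
  rw [hval] at hlim
  have hfar := tendsto_wsum_farFrom hω hD hε
  have hlow := hlim.sub hfar
  rw [sub_zero] at hlow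
  -- The test exceeds the indicator of the ball only at far points, whose mass is negligible.
  refine tendsto_of_tendsto_of_tendsto_of_le_of_le hlow hlim (fun n => ?_) (fun n => ?_)
  · simp only
    rw [sub_le_iff_le_add, ← Diagram.wsum_add]
    refine (D n).wsum_mono hω fun p => ?_
    rw [Pi.add_apply]
    by_cases hp : supDist p q < ε
    · rw [Set.indicator_of_mem (show p ∈ {p | supDist p q < ε} from hp), Pi.one_apply]
      have : (0 : ℝ) ≤ (farFrom D'.mult.support ε).indicator 1 p :=
        Set.indicator_nonneg (fun _ _ => zero_le_one) p
      linarith [h1 p]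
    · rw [Set.indicator_of_notMem (show p ∉ {p | supDist p q < ε} from hp), zero_add]
      by_cases hfp : p ∈ farFrom D'.mult.support ε
      · rw [Set.indicator_of_mem hfp]
        exact h1 p
      · simp only [farFrom, Set.mem_ofPred_eq, not_forall, not_le] at hfp
        obtain ⟨q', hq', hlt⟩ := hfp
        rw [hzero q' hq' (by rintro rfl; exact hp hlt) p hlt]
        exact Set.indicator_nonneg (fun _ _ => zero_le_one) p
  · refine (D n).wsum_mono hω fun p => ?_
    by_cases hp : supDist p q < ε
    · rw [Set.indicator_of_mem (show p ∈ {p | supDist p q < ε} from hp), hone p hp, Pi.one_apply]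
    · rw [Set.indicator_of_notMem (show p ∉ {p | supDist p q < ε} from hp)]
      exact h0 p

theorem norm_sub_le_supDist (p q : Plane) : ‖p - q‖ ≤ 2 * supDist p q := by
  have h0 : |p 0 - q 0| ≤ supDist p q := le_max_left _ _
  have h1 : |p 1 - q 1| ≤ supDist p q := le_max_right _ _
  have hs := supDist_nonneg p q
  rw [EuclideanSpace.norm_eq, Fin.sum_univ_two, Real.sqrt_le_left (by positivity)]
  simp only [PiLp.sub_apply, Real.norm_eq_abs]
  nlinarith [abs_nonneg (p 0 - q 0), abs_nonneg (p 1 - q 1)]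

theorem eventually_abs_weight_sub_le {ω : Plane → ℝ} (hω_cont : ContinuousOn ω upperHalf)
    {q : Plane} (hq : q ∈ upperHalf) {η : ℝ} (hη : 0 < η) :
    ∀ᶠ ε in 𝓝[>] (0 : ℝ), ∀ p ∈ upperHalf, supDist p q < ε → |ω p - ω q| < η := by
  obtain ⟨δ, hδ, h⟩ := Metric.continuousOn_iff.1 hω_cont q hq η hη
  filter_upwards [nhdsWithin_le_nhds (Iio_mem_nhds (half_pos hδ))] with ε hε p hp hpq
  rw [Set.mem_Iio] at hε
  refine h p hp ?_
  rw [dist_eq_norm]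
  linarith [norm_sub_le_supDist p q]

/-- Eventually the diagrams have as many points near a point of the limit diagram as the
multiplicity of that point. -/
theorem eventually_count_near {ω : Plane → ℝ} (hω : ∀ p ∈ upperHalf, 0 < ω p)
    (hω_cont : ContinuousOn ω upperHalf) {D : ℕ → Diagram} {D' : Diagram}
    (hD : Tendsto (fun n => Metric.hausdorffDist (liftZonoid ((D n).reweight ω))
      (liftZonoid (D'.reweight ω))) atTop (𝓝 0)) {q : Plane} (hq : q ∈ D'.mult.support) :
    ∀ᶠ ε in 𝓝[>] (0 : ℝ), ∀ᶠ n in atTop,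
      ∑ p ∈ (D n).mult.support with supDist p q < ε, (D n).mult p = D'.mult q := by
  have hqU := D'.mem_upperHalf q hq
  have hωq := hω q hqU
  set c := D'.mult q with hc
  have hc0 : (0 : ℝ) ≤ c := Nat.cast_nonneg c
  -- With this `η`, a count of at least `c + 1` or at most `c - 1` would move the mass by at least
  -- `ω q / 2` from `ω q * c`.
  set η : ℝ := ω q / (2 * (c + 1)) with hη
  have hη0 : 0 < η := by positivity
  have hηc : η * (c + 1) = ω q / 2 := by rw [hη]; field_simp
  filter_upwards [eventually_tendsto_wsum_near hω hD hq,
    eventually_abs_weight_sub_le hω_cont hqU hη0] with ε hlim hclose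
  filter_upwards [hlim.eventually_lt_const (show ω q * c < ω q * c + ω q / 2 by linarith),
    hlim.eventually_const_lt (show ω q * c - ω q / 2 < ω q * c by linarith)] with n hup hlow
  have hws : (D n).wsum ω ({p | supDist p q < ε}.indicator 1) =
      ∑ p ∈ (D n).mult.support with supDist p q < ε, ω p * (D n).mult p := by
    rw [Diagram.wsum, Finset.sum_filter]
    refine Finset.sum_congr rfl fun p _ => ?_
    by_cases hp : supDist p q < ε <;> simp [hp]
  rw [hws] at hup hlow
  set N := ∑ p ∈ (D n).mult.support with supDist p q < ε, (D n).mult p with hN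
  have hNcast : (N : ℝ) = ∑ p ∈ (D n).mult.support with supDist p q < ε, ((D n).mult p : ℝ) := by
    rw [hN]; push_cast; rfl
  have hle : ∑ p ∈ (D n).mult.support with supDist p q < ε, ω p * (D n).mult p ≤
      (ω q + η) * N := by
    rw [hNcast, Finset.mul_sum]
    refine Finset.sum_le_sum fun p hp => mul_le_mul_of_nonneg_right ?_ (Nat.cast_nonneg _)
    rw [Finset.mem_filter] at hp
    linarith [(abs_lt.1 (hclose p ((D n).mem_upperHalf p hp.1) hp.2)).2]
  have hge : (ω q - η) * N ≤
      ∑ p ∈ (D n).mult.support with supDist p q < ε, ω p * (D n).mult p := by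
    rw [hNcast, Finset.mul_sum]
    refine Finset.sum_le_sum fun p hp => mul_le_mul_of_nonneg_right ?_ (Nat.cast_nonneg _)
    rw [Finset.mem_filter] at hp
    linarith [(abs_lt.1 (hclose p ((D n).mem_upperHalf p hp.1) hp.2)).1]
  have hηω : η ≤ ω q := by nlinarith
  rcases lt_trichotomy N c with h | h | h
  · have h' : (N : ℝ) + 1 ≤ c := by exact_mod_cast h
    nlinarith
  · exact h
  · have h' : (c : ℝ) + 1 ≤ N := by exact_mod_cast h
    nlinarith

/-! ### Tails and persistence -/

theorem setIntegral_toMeasure (D : Diagram) {Z : Set Plane} (hZ : MeasurableSet Z)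
    (f : Plane → ℝ) :
    ∫ p in Z, f p ∂D.toMeasure = ∑ p ∈ D.mult.support, D.mult p * Z.indicator f p := by
  rw [← integral_indicator hZ, Diagram.toMeasure, integral_finsetSum_measure]
  · refine Finset.sum_congr rfl fun p _ => ?_
    rw [integral_smul_measure, integral_dirac]
    simp
  · intro p _
    exact (integrable_dirac (by simp)).smul_measure (by simp)

theorem tendsto_wsum_tail {ω : Plane → ℝ} (hω : ∀ p ∈ upperHalf, 0 < ω p)
    {D : ℕ → Diagram} {D' : Diagram}
    (hD : Tendsto (fun n => Metric.hausdorffDist (liftZonoid ((D n).reweight ω))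
      (liftZonoid (D'.reweight ω))) atTop (𝓝 0)) :
    ∃ R : ℝ, Tendsto (fun n => (D n).wsum ω ((Metric.closedBall (0 : Plane) R)ᶜ.indicator norm))
      atTop (𝓝 0) := by
  obtain ⟨r, hr⟩ : ∃ r : ℝ, ∀ p ∈ D'.mult.support, ‖p‖ ≤ r :=
    (D'.mult.support.finite_toSet.image norm).bddAbove.imp fun r hr p hp =>
      hr (Set.mem_image_of_mem _ hp)
  have h (a b : ℝ) := max_affine_mem_convergentTests hω hD (-r) a b
  -- The four hinges vanish on the limit diagram and sum to at least `|x| + |y| - 2 * r`; doubled,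
  -- this dominates the norm beyond radius `4 * r`.
  have hmem := Submodule.smul_mem _ 2 (add_mem (add_mem (h 1 0) (h (-1) 0))
    (add_mem (h 0 1) (h 0 (-1))))
  have hlim := (show Tendsto _ _ _ from hmem)
  rw [D'.wsum_eq_zero] at hlim
  · refine ⟨4 * r, squeeze_zero (fun n => (D n).wsum_nonneg hω fun p =>
      Set.indicator_nonneg (fun p _ => norm_nonneg p) p)
      (fun n => (D n).wsum_mono hω fun p => ?_) hlim⟩
    simp only [Pi.smul_apply, Pi.add_apply, smul_eq_mul]
    by_cases hp : p ∈ (Metric.closedBall (0 : Plane) (4 * r))ᶜ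
    · rw [Set.indicator_of_mem hp]
      rw [Set.mem_compl_iff, mem_closedBall_zero_iff, not_le] at hp
      have hnorm : ‖p‖ ≤ |p 0| + |p 1| := by
        rw [EuclideanSpace.norm_eq, Fin.sum_univ_two, Real.sqrt_le_left (by positivity)]
        simp only [Real.norm_eq_abs]
        nlinarith [abs_nonneg (p 0), abs_nonneg (p 1)]
      have key (x a b : ℝ) (ha : a = -r + x) (hb : b = -r + -x) :
          |x| - r ≤ max 0 a + max 0 b := by
        subst ha hb
        grind
      have h0 := key (p 0) (-r + 1 * p 0 + 0 * p 1) (-r + -1 * p 0 + 0 * p 1) (by ring) (by ring)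
      have h1 := key (p 1) (-r + 0 * p 0 + 1 * p 1) (-r + 0 * p 0 + -1 * p 1) (by ring) (by ring)
      linarith
    · rw [Set.indicator_of_notMem hp]
      positivity
  · intro p hp
    have hp := hr p hp
    have h0 := (PiLp.norm_apply_le p 0).trans hp
    have h1 := (PiLp.norm_apply_le p 1).trans hp
    rw [Real.norm_eq_abs, abs_le] at h0 h1
    simp only [Pi.smul_apply, Pi.add_apply, smul_eq_mul]
    rw [max_eq_left (by linarith), max_eq_left (by linarith), max_eq_left (by linarith),
      max_eq_left (by linarith)]
    norm_num

/-- Under an effective weighting, the persistence of the diagrams far from the origin is uniformly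
small. -/
theorem exists_forall_persOn_le {ω : Plane → ℝ} (hω : ∀ p ∈ upperHalf, 0 < ω p)
    (hω_eff : IsEffective ω) {D : ℕ → Diagram} {D' : Diagram}
    (hD : Tendsto (fun n => Metric.hausdorffDist (liftZonoid ((D n).reweight ω))
      (liftZonoid (D'.reweight ω))) atTop (𝓝 0)) {ε : ℝ} (hε : 0 < ε) :
    ∃ R : ℝ, ∀ n, persOn (Metric.closedBall (0 : Plane) R)ᶜ (D n).toMeasure ≤ ε := by
  have hint (n : ℕ) (r : ℝ) :
      ∫ p in (Metric.closedBall (0 : Plane) r)ᶜ, ω p * ‖p‖ ∂(D n).toMeasure =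
        (D n).wsum ω ((Metric.closedBall (0 : Plane) r)ᶜ.indicator norm) := by
    rw [setIntegral_toMeasure _ measurableSet_closedBall.compl, Diagram.wsum]
    refine Finset.sum_congr rfl fun p _ => ?_
    by_cases hp : p ∈ (Metric.closedBall (0 : Plane) r)ᶜ
    · rw [Set.indicator_of_mem hp, Set.indicator_of_mem hp]
      ring
    · rw [Set.indicator_of_notMem hp, Set.indicator_of_notMem hp]
      ring
  have hpers := hω_eff D (by
    rw [ENNReal.tendsto_nhds_zero]
    intro e he
    obtain ⟨R, hR⟩ := tendsto_wsum_tail hω hD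
    have hR' := ENNReal.tendsto_ofReal hR
    rw [ENNReal.ofReal_zero, ENNReal.tendsto_nhds_zero] at hR'
    obtain ⟨N, hN⟩ := eventually_atTop.1 (hR' e he)
    -- The supremum runs over all `n`: the finitely many early diagrams have no points beyond a
    -- large radius, and later tails decrease with `r`.
    have hfin : ∀ᶠ r : ℝ in atTop, ∀ n ∈ Finset.range N, ∀ p ∈ (D n).mult.support, ‖p‖ ≤ r := by
      rw [Finset.eventually_all]
      intro n _
      rw [Finset.eventually_all]
      exact fun p _ => eventually_ge_atTop _
    filter_upwards [eventually_ge_atTop R, hfin] with r hr hfin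
    refine iSup_le fun n => ?_
    rw [hint]
    rcases lt_or_ge n N with hn | hn
    · rw [(D n).wsum_eq_zero ω fun p hp => Set.indicator_of_notMem (by
        simpa using hfin n (Finset.mem_range.2 hn) p hp) _]
      simp
    · refine le_trans (ENNReal.ofReal_le_ofReal ((D n).wsum_mono hω fun p => ?_)) (hN n hn)
      exact Set.indicator_le_indicator_of_subset
        (Set.compl_subset_compl.2 (Metric.closedBall_subset_closedBall hr))
        (fun _ => norm_nonneg _) p)
  obtain ⟨R, hR⟩ := (ENNReal.tendsto_nhds_zero.1 hpers _ (ENNReal.ofReal_pos.2 hε)).exists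
  exact ⟨R, fun n => (ENNReal.ofReal_le_ofReal_iff hε.le).1 ((le_iSup _ n).trans hR)⟩

theorem diagDist_nonneg (p : Plane) : 0 ≤ diagDist p := by
  rw [diagDist_eq]
  positivity

/-- The persistence away from a finite set is controlled by the persistence far from the origin
and by the mass of the reweighted diagram away from that finite set. -/
theorem sum_diagDist_farFrom_le {ω : Plane → ℝ} (hω : ∀ p ∈ upperHalf, 0 < ω p) (D : Diagram)
    {R c : ℝ} (hc : 0 < c) (hRc : ∀ p ∈ upperHalf, ‖p‖ ≤ R → c * (p 1 - p 0) ≤ ω p)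
    (Z : Set Plane) :
    ∑ p ∈ D.mult.support, D.mult p * Z.indicator diagDist p ≤
      persOn (Metric.closedBall (0 : Plane) R)ᶜ D.toMeasure +
        c⁻¹ * D.wsum ω (Z.indicator 1) := by
  rw [persOn, setIntegral_toMeasure _ measurableSet_closedBall.compl, Diagram.wsum,
    Finset.mul_sum, Finset.mul_sum, ← Finset.sum_add_distrib]
  refine Finset.sum_le_sum fun p hp => ?_
  have hpU := D.mem_upperHalf p hp
  have hp0 : 0 < p 1 - p 0 := sub_pos.2 hpU
  have hm : (0 : ℝ) ≤ D.mult p := Nat.cast_nonneg _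
  have hd : diagDist p = (p 1 - p 0) / 2 := by rw [diagDist_eq, abs_of_pos hp0]
  by_cases hpR : ‖p‖ ≤ R
  · rw [Set.indicator_of_notMem (s := (Metric.closedBall (0 : Plane) R)ᶜ) (by simpa using hpR)]
    by_cases hZ : p ∈ Z
    · rw [Set.indicator_of_mem hZ, Set.indicator_of_mem hZ, hd, Pi.one_apply]
      have h1 : p 1 - p 0 ≤ c⁻¹ * ω p := by
        rw [le_inv_mul_iff₀ hc]
        exact hRc p hpU hpR
      nlinarith [mul_le_mul_of_nonneg_left h1 hm, mul_nonneg hm hp0.le]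
    · simp [Set.indicator_of_notMem hZ]
  · rw [Set.indicator_of_mem (s := (Metric.closedBall (0 : Plane) R)ᶜ) (by simpa using hpR)]
    have h1 : 0 ≤ c⁻¹ * (ω p * D.mult p * Z.indicator 1 p) :=
      mul_nonneg (inv_nonneg.2 hc.le) (mul_nonneg (D.weight_nonneg hω hp)
        (Set.indicator_nonneg (fun _ _ => zero_le_one) p))
    have h2 : Z.indicator diagDist p ≤ (p 1 - p 0) / 2 := by
      rw [← hd]
      exact Set.indicator_le_self' (fun _ _ => diagDist_nonneg p) p
    nlinarith [mul_le_mul_of_nonneg_left h2 hm]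

/-! ### The matching -/

theorem PartialMatching.cost_nonneg {D D' : Diagram} (γ : PartialMatching D D') : 0 ≤ γ.cost := by
  refine add_nonneg (add_nonneg ?_ ?_) ?_
  · exact Finset.sum_nonneg fun p _ => Finset.sum_nonneg fun q _ =>
      mul_nonneg (Nat.cast_nonneg _) (supDist_nonneg p q)
  · exact Finset.sum_nonneg fun p hp => mul_nonneg
      (sub_nonneg.2 (by exact_mod_cast γ.left_le p hp)) (diagDist_nonneg p)
  · exact Finset.sum_nonneg fun q hq => mul_nonneg
      (sub_nonneg.2 (by exact_mod_cast γ.right_le q hq)) (diagDist_nonneg q)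

theorem W₁_le_cost {D D' : Diagram} (γ : PartialMatching D D') : W₁ D D' ≤ γ.cost :=
  ciInf_le ⟨0, Set.forall_mem_range.2 fun γ => γ.cost_nonneg⟩ γ

theorem W₁_nonneg (D D' : Diagram) : 0 ≤ W₁ D D' :=
  Real.iInf_nonneg fun γ => γ.cost_nonneg

/-- If `D` has around every point of `D'` as many points as the multiplicity of that point, then
matching them bounds the distance of the diagrams. -/
theorem W₁_le_of_count_near {D D' : Diagram} {ε : ℝ}
    (hdisj : ∀ p, ∀ q ∈ D'.mult.support, ∀ q' ∈ D'.mult.support,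
      supDist p q < ε → supDist p q' < ε → q = q')
    (hcount : ∀ q ∈ D'.mult.support,
      ∑ p ∈ D.mult.support with supDist p q < ε, D.mult p = D'.mult q) :
    W₁ D D' ≤ ε * (∑ q ∈ D'.mult.support, D'.mult q : ℕ) +
      ∑ p ∈ D.mult.support, D.mult p * (farFrom D'.mult.support ε).indicator diagDist p := by
  classical
  -- All copies of `p` go to the unique `q` within `ε`, if any. `hcount` saturates every `q`, so no
  -- point of `D'` pays a diagonal cost.
  let a : Plane → Plane → ℕ := fun p q => if supDist p q < ε then D.mult p else 0
  have hright (q) (hq : q ∈ D'.mult.support) : ∑ p ∈ D.mult.support, a p q = D'.mult q := by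
    rw [← hcount q hq, Finset.sum_filter]
  have hnear (p q) (hq : q ∈ D'.mult.support) (hpq : supDist p q < ε) :
      ∑ q ∈ D'.mult.support, a p q = D.mult p := by
    rw [Finset.sum_eq_single_of_mem q hq fun q' hq' hne =>
      if_neg fun h => hne (hdisj p q' hq' q hq h hpq)]
    exact if_pos hpq
  have hfar (p) (hp : p ∈ farFrom D'.mult.support ε) : ∑ q ∈ D'.mult.support, a p q = 0 :=
    Finset.sum_eq_zero fun q hq => if_neg (not_lt.2 (hp q hq))
  have hcases (p) (hp : p ∉ farFrom D'.mult.support ε) :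
      ∃ q ∈ D'.mult.support, supDist p q < ε := by
    simpa [farFrom] using hp
  let γ : PartialMatching D D' :=
    { amount := a
      left_le := fun p _ => by
        by_cases hp : p ∈ farFrom D'.mult.support ε
        · rw [hfar p hp]; exact Nat.zero_le _
        · obtain ⟨q, hq, hpq⟩ := hcases p hp
          exact (hnear p q hq hpq).le
      right_le := fun q hq => (hright q hq).le }
  refine (W₁_le_cost γ).trans ?_
  rw [PartialMatching.cost]
  have h3 : ∑ q ∈ D'.mult.support,
      ((D'.mult q : ℝ) - ∑ p ∈ D.mult.support, (γ.amount p q : ℝ)) * diagDist q = 0 := by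
    refine Finset.sum_eq_zero fun q hq => ?_
    rw [← hright q hq]
    push_cast
    rw [sub_self, zero_mul]
  rw [h3, add_zero]
  refine add_le_add ?_ (Finset.sum_le_sum fun p _ => ?_)
  · rw [Finset.sum_comm]
    push_cast
    rw [Finset.mul_sum]
    refine Finset.sum_le_sum fun q hq => ?_
    rw [← hright q hq]
    push_cast
    rw [Finset.mul_sum]
    refine Finset.sum_le_sum fun p _ => ?_
    rw [mul_comm]
    by_cases hpq : supDist p q < ε
    · exact mul_le_mul_of_nonneg_right hpq.le (Nat.cast_nonneg _)
    · have : γ.amount p q = 0 := if_neg hpq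
      have h' : a p q = 0 := if_neg hpq
      simp [this, h']
  · by_cases hp : p ∈ farFrom D'.mult.support ε
    · rw [Set.indicator_of_mem hp]
      refine mul_le_mul_of_nonneg_right ?_ (diagDist_nonneg p)
      exact sub_le_self _ (Finset.sum_nonneg fun _ _ => Nat.cast_nonneg _)
    · obtain ⟨q, hq, hpq⟩ := hcases p hp
      have h := congrArg (Nat.cast : ℕ → ℝ) (hnear p q hq hpq)
      push_cast at h
      rw [Set.indicator_of_notMem hp, mul_zero]
      exact (mul_eq_zero_of_left (sub_eq_zero.2 h.symm) _).le

/-- A common neighbour would put two ridge values within `2 * δ`, against their separation by `4 *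
δ`. -/
theorem eventually_near_disjoint (S : Finset Plane) :
    ∀ᶠ ε in 𝓝[>] (0 : ℝ), ∀ p, ∀ q ∈ S, ∀ q' ∈ S,
      supDist p q < ε → supDist p q' < ε → q = q' := by
  obtain ⟨t, ht⟩ := (infinite_injOn_ridge S).nonempty
  obtain ⟨δ, hsep, hδ⟩ := ((eventually_ridge_separates ht).and self_mem_nhdsWithin).exists
  replace hδ : 0 < δ := hδ
  have ht0 : 0 < 1 + |t| := by positivity
  have hev : ∀ᶠ ε in 𝓝 (0 : ℝ), (1 + |t|) * ε ≤ δ := by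
    have := (continuous_const_mul (1 + |t|)).tendsto 0
    rw [mul_zero] at this
    exact this.eventually_le_const hδ
  filter_upwards [nhdsWithin_le_nhds hev] with ε hε p q hq q' hq' h h'
  by_contra hne
  have h1 := hsep q hq q' hq' hne
  have h2 := abs_sub_le (ridge t q) (ridge t p) (ridge t q')
  rw [abs_sub_comm (ridge t q) (ridge t p)] at h2
  have h3 := abs_ridge_sub_le t p q
  have h4 := abs_ridge_sub_le t p q'
  have h5 := mul_le_mul_of_nonneg_left h.le ht0.le
  have h6 := mul_le_mul_of_nonneg_left h'.le ht0.le
  linarith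

end PersistenceSphere

open PersistenceSphere in
theorem mainTheorem2
    (ω : PersistenceSphere.Plane → ℝ)
    (hω_pos : ∀ p ∈ PersistenceSphere.upperHalf, 0 < ω p)
    (hω_cont : ContinuousOn ω PersistenceSphere.upperHalf)
    (hω_diag : ∀ R : ℝ, ∃ c : ℝ, 0 < c ∧
      ∀ p ∈ PersistenceSphere.upperHalf, ‖p‖ ≤ R → c * (p 1 - p 0) ≤ ω p)
    (hω_eff : PersistenceSphere.IsEffective ω)
    (D : ℕ → PersistenceSphere.Diagram) (D' : PersistenceSphere.Diagram)
    (hD : Tendsto (fun n => Metric.hausdorffDist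
      (PersistenceSphere.liftZonoid ((D n).reweight ω))
      (PersistenceSphere.liftZonoid (D'.reweight ω))) atTop (𝓝 0)) :
    Tendsto (fun n => PersistenceSphere.W₁ (D n) D') atTop (𝓝 0) := by
  rw [Metric.tendsto_nhds]
  intro e he
  obtain ⟨R, hR⟩ := exists_forall_persOn_le hω_pos hω_eff hD (show 0 < e / 4 by linarith)
  obtain ⟨c, hc, hRc⟩ := hω_diag R
  set M : ℕ := ∑ q ∈ D'.mult.support, D'.mult q with hM
  have hsmall : ∀ᶠ ε in 𝓝 (0 : ℝ), ε * M < e / 4 := by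
    have := (continuous_mul_const (M : ℝ)).tendsto 0
    rw [zero_mul] at this
    exact this.eventually_lt_const (by linarith)
  -- The radius `R` and constant `c` do not depend on `ε`, so `ε` is fixed next and `n` last.
  -- Matching, the tail and the bounded far part each cost at most `e / 4`.
  obtain ⟨ε, ⟨⟨hcount, hdisj⟩, hεM⟩, hε⟩ := (((((Finset.eventually_all _).2 fun q hq =>
    eventually_count_near hω_pos hω_cont hD hq).and
    (eventually_near_disjoint D'.mult.support)).and (nhdsWithin_le_nhds hsmall)).and
    self_mem_nhdsWithin).exists
  have hfar := (tendsto_wsum_farFrom hω_pos hD hε).const_mul c⁻¹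
  rw [mul_zero] at hfar
  filter_upwards [(Finset.eventually_all _).2 hcount,
    hfar.eventually_lt_const (show 0 < e / 4 by linarith)] with n hn hfn
  rw [Real.dist_eq, sub_zero, abs_of_nonneg (W₁_nonneg _ _)]
  have h1 := W₁_le_of_count_near hdisj hn
  have h2 := sum_diagDist_farFrom_le hω_pos (D n) hc hRc (farFrom D'.mult.support ε)
  have h3 := hR n
  linarith
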